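/- Let $n\ge 1$ and let $m=(m_1,\dots,m_n)$ be an $n$-tuple of positive integers. A domain (that is, a connected open set) $D\subset\mathbb C^n$ is called quasi-circular with weight $m$ if $(e^{im_1\theta}z_1,\dots,e^{im_n\theta}z_n)\in D$ for all $z\in D$ and all $\theta\in\mathbb R$; it is circular if moreover $m_1=\dots=m_n$. The resonance order of $m$ is $$\mu=\max\Bigl\{|\alpha| : \alpha\in\mathbb Z_{\ge 0}^n,\ m_1\alpha_1+\dots+m_n\alpha_n=m_i\text{ for some }1\le i\le n\Bigr\},\qquad |\alpha|=\alpha_1+\dots+\alpha_n.$$ (a) Let $D\subset\mathbb C^n$ be a bounded quasi-circular domain with weight $m$ containing the origin, and let $f$ be an automorphism of $D$ (a holomorphic map $D\to D$ with a holomorphic inverse) such that $f(0)=0$. If the resonance order of $m$ equals $1$, then $f$ is linear, i.e. it is the restriction to $D$ of a $\mathbb C$-linear map $\mathbb C^n\to\mathbb C^n$. (b) If $m_1=\dots=m_n$, then the resonance order of $m$ is $1$. So (a) contains Cartan's theorem, which is (a) for bounded circular domains. (c) If $n=2$, $2\le m_1\le m_2$ and $\gcd(m_1,m_2)=1$ (normal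 weights), then the resonance order of $m$ is $1$. So (a) contains Yamamori's result, which is (a) for bounded normal quasi-circular domains in $\mathbb C^2$. -/

import Mathlib

namespace QuasiCircular

/-- The action of `θ ∈ ℝ` on `ℂⁿ` with weight `m`:
`(z₁, …, zₙ) ↦ (e^{i m₁ θ} z₁, …, e^{i mₙ θ} zₙ)`. -/
noncomputable def rotation {n : ℕ} (m : Fin n → ℕ) (θ : ℝ) (z : Fin n → ℂ) : Fin n → ℂ :=
  fun j => Complex.exp (Complex.I * (m j : ℂ) * (θ : ℂ)) * z j

/-- `D ⊆ ℂⁿ` is a quasi-circular domain of weight `m`: the weights are positive integers, `D` is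
open and connected, and `D` is invariant under all the rotations of weight `m`. -/
structure IsQuasiCircularDomain {n : ℕ} (m : Fin n → ℕ) (D : Set (Fin n → ℂ)) : Prop where
  weight_pos : ∀ j, 0 < m j
  isOpen : IsOpen D
  isConnected : IsConnected D
  rotation_mem : ∀ θ : ℝ, ∀ z ∈ D, rotation m θ z ∈ D

/-- `f` restricts to a holomorphic automorphism of `D`: a holomorphic map of `D` into itself
with a holomorphic two-sided inverse on `D`. Values of `f` off `D` are irrelevant. -/
def IsAutomorphism {n : ℕ} (D : Set (Fin n → ℂ)) (f : (Fin n → ℂ) → (Fin n → ℂ)) : Prop :=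
  DifferentiableOn ℂ f D ∧ Set.MapsTo f D D ∧
    ∃ g : (Fin n → ℂ) → (Fin n → ℂ),
      DifferentiableOn ℂ g D ∧ Set.MapsTo g D D ∧ Set.InvOn g f D D

/-- The `i`-th resonance set `Eᵢ = {α : m · α = mᵢ}`, a set of multi-indices. -/
def resonanceSetAt {n : ℕ} (m : Fin n → ℕ) (i : Fin n) : Set (Fin n → ℕ) :=
  {α | ∑ j, m j * α j = m i}

/-- The resonance set `E = ⋃ᵢ Eᵢ`. -/
def resonanceSet {n : ℕ} (m : Fin n → ℕ) : Set (Fin n → ℕ) :=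
  ⋃ i, resonanceSetAt m i

/-- The resonance order `max {|α| : α ∈ E}`, where `|α| = α₁ + ⋯ + αₙ`. For positive weights and
`n ≥ 1` this supremum is a maximum, see `isGreatest_resonanceOrder`. -/
noncomputable def resonanceOrder {n : ℕ} (m : Fin n → ℕ) : ℕ :=
  sSup ((fun α : Fin n → ℕ => ∑ j, α j) '' resonanceSet m)

theorem isGreatest_resonanceOrder {n : ℕ} (hn : 0 < n) (m : Fin n → ℕ) (hm : ∀ j, 0 < m j) :
    IsGreatest ((fun α : Fin n → ℕ => ∑ j, α j) '' resonanceSet m) (resonanceOrder m) := by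
  have hne : ((fun α : Fin n → ℕ => ∑ j, α j) '' resonanceSet m).Nonempty := by
    refine ⟨_, Pi.single ⟨0, hn⟩ 1, Set.mem_iUnion.2 ⟨⟨0, hn⟩, ?_⟩, rfl⟩
    simp [resonanceSetAt, Pi.single_apply]
  have hb : BddAbove ((fun α : Fin n → ℕ => ∑ j, α j) '' resonanceSet m) := by
    refine ⟨∑ j, m j, ?_⟩
    rintro _ ⟨α, hα, rfl⟩
    obtain ⟨i, hi⟩ := Set.mem_iUnion.1 hα
    calc ∑ j, α j ≤ ∑ j, m j * α j :=
          Finset.sum_le_sum fun j _ => Nat.le_mul_of_pos_left _ (hm j)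
      _ = m i := hi
      _ ≤ ∑ j, m j := Finset.single_le_sum (fun j _ => Nat.zero_le (m j)) (Finset.mem_univ i)
  exact ⟨Nat.sSup_mem hne hb, fun a ha => le_csSup hb ha⟩

end QuasiCircular

namespace QuasiCircular

open Set Metric Filter Topology MeasureTheory

/-! Write ρ_θ for the rotations. If σ is holomorphic on D and tangent to the identity at 0, the mean
over θ of ρ_{-θ} ∘ σ ∘ ρ_θ is the identity: its i-th component has weight m_i, so near 0 only
monomials z^α with m·α = m_i can occur, and resonance order 1 leaves only linear ones
(`integral_rotation_neg_apply`).

For an automorphism g fixing 0, with inverse g', let E(g, σ) be the squared L² norm over D of dg'(0)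
∘ σ ∘ g. Let S be the supremum of E(g, id) over the isotropy group, finite by Cauchy estimates.
Given h in the group, let σ be the midpoint of id and dh'(0) ∘ h. If dh'(0) ∘ h ≠ id, then E(g,
dh'(0) ∘ h - id) ≥ η > 0 uniformly in g (`exists_pos_le_energy`), and the parallelogram law
(`energy_midpoint`) gives E(g, σ) ≤ S - η/4 for every g. Averaging and Jensen's inequality
(`energy_id_le`) turn this into E(g, id) ≤ S - η/4 for every g, contradicting the choice of S. Hence
dh'(0) ∘ h = id and h is linear. The statements on particular weights are arithmetic. -/

/-! ### Holomorphic functions of several variables -/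

/-- Differentiation under the integral sign for `x ↦ ∫ θ in a..b, c θ * f (ℓ θ x + p θ)`, with `f`
holomorphic. -/
theorem hasFDerivAt_integral_comp_affine {E : Type*} [NormedAddCommGroup E] [NormedSpace ℂ E]
    [FiniteDimensional ℂ E] {f : E → ℂ} {D : Set E} (hD : IsOpen D)
    (hf : DifferentiableOn ℂ f D) {c : ℝ → ℂ} (hc : Continuous c) {ℓ : ℝ → E →L[ℂ] E}
    (hℓ : Continuous ℓ) {p : ℝ → E} (hp : Continuous p) (a b : ℝ) (x₀ : E)
    (hx₀ : ∀ θ ∈ uIcc a b, ℓ θ x₀ + p θ ∈ D) :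
    HasFDerivAt (fun x => ∫ θ in a..b, c θ * f (ℓ θ x + p θ))
      (∫ θ in a..b, c θ • (fderiv ℂ f (ℓ θ x₀ + p θ)).comp (ℓ θ)) x₀ := by
  borelize E
  have : ProperSpace E := FiniteDimensional.proper ℂ E
  have hcont : Continuous fun z : E × ℝ => ℓ z.2 z.1 + p z.2 := by fun_prop
  have hfc : ∀ x, (∀ θ ∈ uIcc a b, ℓ θ x + p θ ∈ D) →
      ContinuousOn (fun θ => c θ * f (ℓ θ x + p θ)) (uIcc a b) := fun x hx =>
    hc.continuousOn.mul (hf.continuousOn.comp (by fun_prop) hx)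
  obtain ⟨C, hC⟩ := isCompact_uIcc.exists_bound_of_continuousOn (hfc x₀ hx₀)
  -- Compactness of the interval gives one neighbourhood of x₀ that serves every θ.
  have hev : ∀ᶠ x in 𝓝 x₀, ∀ θ ∈ uIcc a b,
      ℓ θ x + p θ ∈ D ∧ ‖c θ * f (ℓ θ x + p θ)‖ < C + 1 := by
    refine isCompact_uIcc.eventually_forall_of_forall_eventually fun θ hθ => ?_
    have h1 : ∀ᶠ z : E × ℝ in 𝓝 (x₀, θ), ℓ z.2 z.1 + p z.2 ∈ D :=
      hcont.continuousAt.eventually (hD.mem_nhds (hx₀ θ hθ))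
    have h2 : ContinuousAt (fun z : E × ℝ => ‖c z.2 * f (ℓ z.2 z.1 + p z.2)‖) (x₀, θ) := by
      have h3 : ContinuousAt (fun z : E × ℝ => f (ℓ z.2 z.1 + p z.2)) (x₀, θ) :=
        ContinuousAt.comp (f := fun z : E × ℝ => ℓ z.2 z.1 + p z.2)
          ((hf.differentiableAt (hD.mem_nhds (hx₀ θ hθ))).continuousAt) hcont.continuousAt
      exact ((hc.comp continuous_snd).continuousAt.mul h3).norm
    exact h1.and (h2.eventually_lt_const ((hC θ hθ).trans_lt (lt_add_one C)))
  obtain ⟨ε, hε, hball⟩ := Metric.eventually_nhds_iff_ball.1 hev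
  have hdiff : ∀ θ ∈ uIcc a b, ∀ x ∈ ball x₀ ε,
      HasFDerivAt (fun x => c θ * f (ℓ θ x + p θ))
        (c θ • (fderiv ℂ f (ℓ θ x + p θ)).comp (ℓ θ)) x := by
    intro θ hθ x hx
    have h1 := (hf.differentiableAt (hD.mem_nhds (hball x hx θ hθ).1)).hasFDerivAt
    have h2 : HasFDerivAt (fun x => ℓ θ x + p θ) (ℓ θ) x :=
      (ℓ θ).hasFDerivAt.add_const _
    exact HasFDerivAt.const_mul (HasFDerivAt.comp x h1 h2) (c θ)
  -- The dominating constant is a Cauchy estimate: on a ball of radius ε/2 about x, still inside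
  -- `ball x₀ ε`, the integrand varies by at most 2(C + 1).
  refine intervalIntegral.hasFDerivAt_integral_of_dominated_of_fderiv_le (𝕜 := ℂ) (H := E)
    (s := ball x₀ (ε / 2)) (F' := fun x θ => c θ • (fderiv ℂ f (ℓ θ x + p θ)).comp (ℓ θ))
    (bound := fun _ => (2 * (C + 1)) / (ε / 2)) (ball_mem_nhds x₀ (half_pos hε)) ?_ ?_ ?_ ?_ ?_ ?_
  · filter_upwards [ball_mem_nhds x₀ hε] with x hx
    exact ((hfc x fun θ hθ => (hball x hx θ hθ).1).mono uIoc_subset_uIcc).aestronglyMeasurable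
      measurableSet_uIoc
  · exact (hfc x₀ hx₀).intervalIntegrable
  · have h1 : Measurable fun θ => fderiv ℂ f (ℓ θ x₀ + p θ) :=
      (measurable_fderiv ℂ f).comp (by fun_prop : Continuous fun θ => ℓ θ x₀ + p θ).measurable
    have h2 : StronglyMeasurable fun θ => fderiv ℂ f (ℓ θ x₀ + p θ) := h1.stronglyMeasurable
    have h3 : StronglyMeasurable fun θ => ((fderiv ℂ f (ℓ θ x₀ + p θ)).comp (ℓ θ)) :=
      (by fun_prop : Continuous fun q : (E →L[ℂ] ℂ) × (E →L[ℂ] E) =>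
        q.1.comp q.2).comp_stronglyMeasurable (h2.prodMk hℓ.stronglyMeasurable)
    exact (hc.stronglyMeasurable.smul h3).aestronglyMeasurable
  · refine Eventually.of_forall fun θ hθ x hx => ?_
    have hθ' := uIoc_subset_uIcc hθ
    have hsub : ball x (ε / 2) ⊆ ball x₀ ε := fun y hy => by
      have := dist_triangle y x x₀
      rw [mem_ball] at *; linarith
    have hxε : x ∈ ball x₀ ε := hsub (mem_ball_self (half_pos hε))
    have hd := hdiff θ hθ'
    rw [← (hd x hxε).fderiv]
    refine Complex.norm_fderiv_le_div_of_mapsTo_ball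
      (fun y hy => (hd y (hsub hy)).differentiableAt.differentiableWithinAt) (fun y hy => ?_)
      (half_pos hε)
    rw [mem_closedBall, dist_eq_norm]
    have := norm_sub_le (c θ * f (ℓ θ y + p θ)) (c θ * f (ℓ θ x + p θ))
    have h1 := (hball y (hsub hy) θ hθ').2
    have h2 := (hball x hxε θ hθ').2
    linarith
  · exact intervalIntegrable_const
  · refine Eventually.of_forall fun θ hθ x hx => hdiff θ (uIoc_subset_uIcc hθ) x ?_
    exact ball_subset_ball (by linarith) hx

/-- Cauchy's formula on the complex line x + tv writes the derivative along v as a circle integral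
of f(x + tv), which is holomorphic in x by differentiation under the integral. -/
theorem differentiableOn_fderiv_apply {E : Type*} [NormedAddCommGroup E] [NormedSpace ℂ E]
    [FiniteDimensional ℂ E] {f : E → ℂ} {D : Set E} (hD : IsOpen D)
    (hf : DifferentiableOn ℂ f D) (v : E) :
    DifferentiableOn ℂ (fun x => fderiv ℂ f x v) D := by
  intro x₀ hx₀
  refine DifferentiableAt.differentiableWithinAt ?_
  have hev : ∀ᶠ z : E × ℂ in 𝓝 (x₀, 0), z.1 + z.2 • v ∈ D := by
    have h : Continuous fun z : E × ℂ => z.1 + z.2 • v := by fun_prop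
    exact h.continuousAt.eventually_mem (by simpa using hD.mem_nhds hx₀)
  obtain ⟨ε, hε, hball⟩ := Metric.eventually_nhds_iff_ball.1 hev
  have hr : 0 < ε / 2 := half_pos hε
  have hmem : ∀ x ∈ ball x₀ ε, ∀ t ∈ closedBall (0 : ℂ) (ε / 2), x + t • v ∈ D := by
    intro x hx t ht
    refine hball (x, t) ?_
    rw [← ball_prod_same]
    exact ⟨hx, closedBall_subset_ball (by linarith) ht⟩
  set c : ℝ → ℂ := fun θ => deriv (circleMap 0 (ε / 2)) θ * (1 / (circleMap 0 (ε / 2) θ - 0) ^ 2)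
  have hc : Continuous c := by
    have h0 : ∀ θ, (circleMap 0 (ε / 2) θ - 0) ^ 2 ≠ 0 := fun θ => by
      simpa using hr.ne'
    have h1 : Continuous (circleMap 0 (ε / 2)) := continuous_circleMap 0 _
    have h2 : Continuous (deriv (circleMap 0 (ε / 2))) := by
      simp only [funext (deriv_circleMap 0 (ε / 2))]
      fun_prop
    exact h2.mul (continuous_const.div (by fun_prop) h0)
  have hint := hasFDerivAt_integral_comp_affine hD hf hc
    (ℓ := fun _ => ContinuousLinearMap.id ℂ E) continuous_const
    (p := fun θ => circleMap 0 (ε / 2) θ • v)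
    ((continuous_circleMap 0 _).smul continuous_const) 0 (2 * Real.pi) x₀ (fun θ _ =>
      hmem x₀ (mem_ball_self hε) _ (circleMap_mem_closedBall 0 hr.le θ))
  refine ((hint.differentiableAt.const_mul (2 * Real.pi * Complex.I)⁻¹)).congr_of_eventuallyEq ?_
  filter_upwards [ball_mem_nhds x₀ hε] with x hx
  have hd : ∀ t ∈ closedBall (0 : ℂ) (ε / 2),
      HasDerivAt (fun t : ℂ => f (x + t • v)) (fderiv ℂ f (x + t • v) v) t := by
    intro t ht
    have h1 := (hf.differentiableAt (hD.mem_nhds (hmem x hx t ht))).hasFDerivAt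
    have h2 : HasDerivAt (fun t : ℂ => x + t • v) v t := by
      simpa using ((hasDerivAt_id t).smul_const v).const_add x
    exact h1.comp_hasDerivAt t h2
  have h0 := (hd 0 (mem_closedBall_self hr.le)).deriv
  have hci := DifferentiableOn.deriv_eq_smul_circleIntegral hr
    (fun t ht => (hd t ht).differentiableAt.differentiableWithinAt)
  simp only [zero_smul, add_zero] at h0
  rw [h0, circleIntegral] at hci
  have hpi : (2 * Real.pi * Complex.I : ℂ) ≠ 0 := Complex.two_pi_I_ne_zero
  rw [eq_inv_mul_iff_mul_eq₀ hpi, ← smul_eq_mul, ← hci]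
  refine intervalIntegral.integral_congr fun θ _ => ?_
  simp [c, mul_assoc]

/-- The identity theorem for holomorphic maps in several variables. -/
theorem eqOn_zero_of_eventuallyEq_zero {E F : Type*} [NormedAddCommGroup E] [NormedSpace ℂ E]
    [NormedAddCommGroup F] [NormedSpace ℂ F] [CompleteSpace F] {f : E → F} {D : Set E}
    (hD : IsOpen D) (hc : IsPreconnected D) (hf : DifferentiableOn ℂ f D) {x₀ : E} (hx₀ : x₀ ∈ D)
    (h0 : f =ᶠ[𝓝 x₀] 0) : EqOn f 0 D := by
  set u : Set E := {x | f =ᶠ[𝓝 x] 0}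
  have hu : IsOpen u := isOpen_setOfPred_eventually_nhds
  suffices h : D ⊆ u from fun x hx => (h hx).eq_of_nhds
  refine hc.subset_of_closure_inter_subset hu ⟨x₀, hx₀, h0⟩ ?_
  rintro x ⟨hxu, hxD⟩
  obtain ⟨r, hr, hsub⟩ := Metric.isOpen_iff.1 hD x hxD
  obtain ⟨y, hyu, hyx⟩ := Metric.mem_closure_iff.1 hxu r hr
  have hy : y ∈ ball x r := by rwa [mem_ball, dist_comm]
  filter_upwards [ball_mem_nhds x hr] with w hw
  -- The complex line through y and w meets the ball in a convex set of parameters containing 0 and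
  -- 1, so the one-variable identity theorem carries the vanishing near y over to w.
  set ℓ : ℂ → E := fun t => y + t • (w - y)
  have hℓ : Continuous ℓ := by fun_prop
  set V : Set ℂ := ℓ ⁻¹' ball x r
  have hVo : IsOpen V := isOpen_ball.preimage hℓ
  have hVc : Convex ℝ V := by
    intro s hs t ht a b ha hb hab
    have hconv := convex_ball x r hs ht ha hb hab
    have : a • ℓ s + b • ℓ t = ℓ (a • s + b • t) := by
      simp only [ℓ, smul_add, add_smul, smul_assoc]
      have : y = a • y + b • y := by rw [← add_smul, hab, one_smul]
      nth_rewrite 5 [this]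
      abel
    rwa [this] at hconv
  have han : AnalyticOnNhd ℂ (f ∘ ℓ) V :=
    DifferentiableOn.analyticOnNhd
      ((hf.mono hsub).comp (by fun_prop : Differentiable ℂ ℓ).differentiableOn
        (mapsTo_preimage _ _)) hVo
  have hz : (f ∘ ℓ) =ᶠ[𝓝 0] 0 := by
    have h1 : Tendsto ℓ (𝓝 0) (𝓝 y) := by
      have := hℓ.tendsto 0
      simpa [ℓ] using this
    exact h1.eventually hyu
  have h0V : (0 : ℂ) ∈ V := by simpa [V, ℓ] using hy
  have h1V : (1 : ℂ) ∈ V := by simpa [V, ℓ] using hw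
  have := han.eqOn_zero_of_preconnected_of_eventuallyEq_zero hVc.isPreconnected h0V hz h1V
  simpa [ℓ] using this

/-! ### The circle action and functions of a given weight -/

/-- `rotation m θ` as a continuous linear map. -/
noncomputable def rotationCLM {n : ℕ} (m : Fin n → ℕ) (θ : ℝ) :
    (Fin n → ℂ) →L[ℂ] (Fin n → ℂ) :=
  ContinuousLinearMap.pi fun j =>
    Complex.exp (Complex.I * (m j : ℂ) * (θ : ℂ)) • ContinuousLinearMap.proj j

theorem rotationCLM_apply {n : ℕ} (m : Fin n → ℕ) (θ : ℝ) (z : Fin n → ℂ) :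
    rotationCLM m θ z = rotation m θ z := rfl

theorem norm_exp_I_mul_mul (k : ℕ) (θ : ℝ) :
    ‖Complex.exp (Complex.I * (k : ℂ) * (θ : ℂ))‖ = 1 := by
  have : Complex.I * (k : ℂ) * (θ : ℂ) = ((k * θ : ℝ) : ℂ) * Complex.I := by push_cast; ring
  rw [this, Complex.norm_exp_ofReal_mul_I]

theorem norm_rotation {n : ℕ} (m : Fin n → ℕ) (θ : ℝ) (z : Fin n → ℂ) :
    ‖rotation m θ z‖ = ‖z‖ := by
  simp only [Pi.norm_def, rotation]
  congr 1
  refine Finset.sup_congr rfl fun j _ => ?_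
  ext
  simp [norm_exp_I_mul_mul]

theorem rotation_zero_right {n : ℕ} (m : Fin n → ℕ) (θ : ℝ) : rotation m θ 0 = 0 := by
  ext; simp [rotation]

theorem rotation_rotation {n : ℕ} (m : Fin n → ℕ) (θ φ : ℝ) (z : Fin n → ℂ) :
    rotation m θ (rotation m φ z) = rotation m (φ + θ) z := by
  ext j
  simp only [rotation, ← mul_assoc, ← Complex.exp_add]
  congr 2
  push_cast
  ring

theorem rotation_zero_left {n : ℕ} (m : Fin n → ℕ) (z : Fin n → ℂ) : rotation m 0 z = z := by
  ext; simp [rotation]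

theorem rotation_neg_rotation {n : ℕ} (m : Fin n → ℕ) (θ : ℝ) (z : Fin n → ℂ) :
    rotation m (-θ) (rotation m θ z) = z := by
  rw [rotation_rotation, add_neg_cancel, rotation_zero_left]

theorem rotation_mem_ball {n : ℕ} (m : Fin n → ℕ) (θ : ℝ) {z : Fin n → ℂ} {R : ℝ}
    (hz : z ∈ ball (0 : Fin n → ℂ) R) : rotation m θ z ∈ ball (0 : Fin n → ℂ) R := by
  rw [mem_ball_zero_iff] at *
  rwa [norm_rotation]

theorem continuous_rotationCLM {n : ℕ} (m : Fin n → ℕ) : Continuous (rotationCLM m) := by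
  refine (ContinuousLinearMap.piEquivL ..).continuous.comp (continuous_pi fun j => ?_)
  fun_prop

/-- A function `G` on the ball of radius `R` has weight `w` if
`G (rotation m θ z) = e^{i w θ} G z`. -/
def HasWeightOnBall {n : ℕ} (m : Fin n → ℕ) (R : ℝ) (w : ℤ) (G : (Fin n → ℂ) → ℂ) : Prop :=
  ∀ θ : ℝ, ∀ z ∈ ball (0 : Fin n → ℂ) R,
    G (rotation m θ z) = Complex.exp (Complex.I * (w : ℂ) * (θ : ℂ)) * G z

/-- The basis vector e_j is an eigenvector of the rotation with eigenvalue e^{i m_j θ}; the chain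
rule moves this factor across the weight relation. This replaces power series: weights are lowered
by differentiating. -/
theorem HasWeightOnBall.fderiv_single {n : ℕ} {m : Fin n → ℕ} {R : ℝ} {w : ℤ}
    {G : (Fin n → ℂ) → ℂ} (h : HasWeightOnBall m R w G)
    (hG : DifferentiableOn ℂ G (ball 0 R)) (j : Fin n) :
    HasWeightOnBall m R (w - m j) (fun z => fderiv ℂ G z (Pi.single j 1)) := by
  intro θ z hz
  have h1 : HasFDerivAt (fun z => G (rotation m θ z))
      ((fderiv ℂ G (rotation m θ z)).comp (rotationCLM m θ)) z :=
    HasFDerivAt.comp z (hG.differentiableAt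
      (isOpen_ball.mem_nhds (rotation_mem_ball m θ hz))).hasFDerivAt (rotationCLM m θ).hasFDerivAt
  have h2 : HasFDerivAt (fun z => G (rotation m θ z))
      (Complex.exp (Complex.I * (w : ℂ) * (θ : ℂ)) • fderiv ℂ G z) z := by
    refine ((hG.differentiableAt (isOpen_ball.mem_nhds hz)).hasFDerivAt.const_mul
      (Complex.exp (Complex.I * (w : ℂ) * (θ : ℂ)))).congr_of_eventuallyEq ?_
    filter_upwards [isOpen_ball.mem_nhds hz] with y hy using h θ y hy
  have h3 := congrArg (fun L => L (Pi.single j 1)) (h1.unique h2)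
  have h4 : rotationCLM m θ (Pi.single j 1) =
      Complex.exp (Complex.I * (m j : ℂ) * (θ : ℂ)) • (Pi.single j 1 : Fin n → ℂ) := by
    ext k
    rcases eq_or_ne k j with rfl | hk
    · simp [rotationCLM_apply, rotation]
    · simp [rotationCLM_apply, rotation, hk]
  simp only [ContinuousLinearMap.comp_apply, h4, map_smul, smul_eq_mul,
    _root_.smul_apply] at h3
  have h5 : Complex.exp (Complex.I * ((w - m j : ℤ) : ℂ) * (θ : ℂ)) *
      Complex.exp (Complex.I * (m j : ℂ) * (θ : ℂ)) =
      Complex.exp (Complex.I * (w : ℂ) * (θ : ℂ)) := by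
    rw [← Complex.exp_add]
    congr 1
    push_cast
    ring
  refine mul_left_cancel₀ (Complex.exp_ne_zero (Complex.I * (m j : ℂ) * (θ : ℂ))) ?_
  rw [h3, ← h5]
  ring

theorem eq_apply_zero_of_fderiv_single_eq_zero {n : ℕ} {R : ℝ} {G : (Fin n → ℂ) → ℂ}
    (hG : DifferentiableOn ℂ G (ball 0 R))
    (h : ∀ j, ∀ z ∈ ball (0 : Fin n → ℂ) R, fderiv ℂ G z (Pi.single j 1) = 0)
    {z : Fin n → ℂ} (hz : z ∈ ball 0 R) : G z = G 0 := by
  have hR : 0 < R := pos_of_mem_ball hz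
  refine (convex_ball (0 : Fin n → ℂ) R).is_const_of_fderivWithin_eq_zero (𝕜 := ℂ) hG ?_ hz
    (mem_ball_self hR)
  intro y hy
  rw [fderivWithin_of_isOpen isOpen_ball hy]
  ext v
  rw [← Finset.univ_sum_single v, map_sum, _root_.zero_apply]
  refine Finset.sum_eq_zero fun j _ => ?_
  have : (Pi.single j (v j) : Fin n → ℂ) = v j • Pi.single j 1 := by
    rw [← Pi.single_smul, smul_eq_mul, mul_one]
  rw [this, map_smul, h j y hy, smul_zero]

/-- For w = -k, the function t^k G(t^{m_1} z_1, …, t^{m_n} z_n) is holomorphic on the disc and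
equals G(z) on the unit circle, hence everywhere in the disc; at t = 0 it vanishes. -/
theorem HasWeightOnBall.eq_zero_of_neg {n : ℕ} {m : Fin n → ℕ} {R : ℝ} {w : ℤ}
    {G : (Fin n → ℂ) → ℂ} (h : HasWeightOnBall m R w G)
    (hG : DifferentiableOn ℂ G (ball 0 R)) (hw : w < 0) {z : Fin n → ℂ} (hz : z ∈ ball 0 R) :
    G z = 0 := by
  obtain ⟨k, rfl⟩ : ∃ k : ℕ, w = -k := ⟨w.natAbs, by omega⟩
  have hk : k ≠ 0 := by rintro rfl; simp at hw
  set ℓ : ℂ → (Fin n → ℂ) := fun t j => t ^ m j * z j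
  have hℓ : Differentiable ℂ ℓ := differentiable_pi.2 fun j => by fun_prop
  have hmaps : ∀ t ∈ closedBall (0 : ℂ) 1, ℓ t ∈ ball (0 : Fin n → ℂ) R := by
    intro t ht
    rw [mem_ball_zero_iff] at *
    rw [mem_closedBall_zero_iff] at ht
    refine lt_of_le_of_lt ((pi_norm_le_iff_of_nonneg (norm_nonneg z)).2 fun j => ?_) hz
    rw [norm_mul, norm_pow]
    calc ‖t‖ ^ m j * ‖z j‖ ≤ 1 * ‖z j‖ := by
          gcongr; exact pow_le_one₀ (norm_nonneg _) ht
      _ ≤ ‖z‖ := by rw [one_mul]; exact norm_le_pi_norm z j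
  have hd : DiffContOnCl ℂ (fun t => t ^ k * G (ℓ t)) (ball 0 1) := by
    refine DifferentiableOn.diffContOnCl ?_
    rw [closure_ball _ one_ne_zero]
    exact (differentiable_pow k).differentiableOn.mul (hG.comp hℓ.differentiableOn hmaps)
  have heq : EqOn (fun t => t ^ k * G (ℓ t)) (fun _ => G z) (ball 0 1) := by
    refine Complex.eqOn_of_eqOn_frontier isBounded_ball hd diffContOnCl_const fun t ht => ?_
    rw [frontier_ball _ one_ne_zero, mem_sphere_zero_iff_norm] at ht
    obtain ⟨θ, rfl⟩ := (Complex.norm_eq_one_iff t).1 ht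
    have h1 : ℓ (Complex.exp (θ * Complex.I)) = rotation m θ z := by
      ext j
      simp only [ℓ, rotation, ← Complex.exp_nat_mul]
      congr 2
      ring
    simp only [h1, h θ z hz, ← mul_assoc, ← Complex.exp_nat_mul, ← Complex.exp_add]
    have : (k : ℂ) * θ * Complex.I + Complex.I * ((-(k : ℤ) : ℤ) : ℂ) * θ = 0 := by
      push_cast; ring
    rw [this, Complex.exp_zero, one_mul]
  simpa [hk] using (heq (mem_ball_self one_pos)).symm

/-- At θ = π/w the factor is -1. -/
theorem eq_zero_of_forall_exp_mul {w : ℤ} (hw : w ≠ 0) {a : ℂ}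
    (h : ∀ θ : ℝ, a = Complex.exp (Complex.I * (w : ℂ) * (θ : ℂ)) * a) : a = 0 := by
  have h1 := h (Real.pi / w)
  have hw' : (w : ℂ) ≠ 0 := by exact_mod_cast hw
  have h2 : Complex.I * (w : ℂ) * ((Real.pi / w : ℝ) : ℂ) = Real.pi * Complex.I := by
    push_cast; field_simp
  rw [h2, Complex.exp_pi_mul_I, neg_one_mul, eq_neg_iff_add_eq_zero, ← two_mul] at h1
  simpa using h1

/-- A holomorphic function of weight `w` vanishes if no monomial has weight `w`. -/
theorem HasWeightOnBall.eq_zero {n : ℕ} {m : Fin n → ℕ} (hm : ∀ j, 0 < m j) {R : ℝ} {w : ℤ}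
    {G : (Fin n → ℂ) → ℂ} (h : HasWeightOnBall m R w G)
    (hG : DifferentiableOn ℂ G (ball 0 R))
    (hα : ∀ α : Fin n → ℕ, ((∑ j, m j * α j : ℕ) : ℤ) ≠ w) {z : Fin n → ℂ}
    (hz : z ∈ ball 0 R) : G z = 0 := by
  obtain ⟨N, hN⟩ : ∃ N : ℕ, w < N := ⟨w.natAbs + 1, by omega⟩
  -- Induction on a strict upper bound N of the weight. The partial derivative along e_j has weight
  -- w - m_j, and no monomial has that weight, since multiplying it by z_j would give weight w. So G
  -- is constant, and the constant is 0 because w ≠ 0 (take α = 0).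
  induction N generalizing w G z with
  | zero => exact h.eq_zero_of_neg hG (by simpa using hN) hz
  | succ N ih =>
    have hw : w ≠ 0 := fun hw => hα 0 (by simp [hw])
    have h0 : ∀ z ∈ ball (0 : Fin n → ℂ) R, G z = G 0 := fun z hz => by
      refine eq_apply_zero_of_fderiv_single_eq_zero hG (fun j y hy => ?_) hz
      refine ih (h.fderiv_single hG j) (differentiableOn_fderiv_apply isOpen_ball hG _)
        (fun α hαj => hα (α + Pi.single j 1) ?_) hy ?_
      · simp only [Pi.add_apply, mul_add, Finset.sum_add_distrib]
        push_cast at hαj ⊢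
        rw [hαj]
        simp [Pi.single_apply]
      · have := hm j
        push_cast at hN
        omega
    rw [h0 z hz]
    refine eq_zero_of_forall_exp_mul hw fun θ => ?_
    have := h θ 0 (mem_ball_self (pos_of_mem_ball hz))
    rwa [rotation_zero_right] at this

/-- A holomorphic function of weight `w > 0` is linear if every monomial of weight `w` has
degree at most one. -/
theorem HasWeightOnBall.eq_fderiv {n : ℕ} {m : Fin n → ℕ} (hm : ∀ j, 0 < m j) {R : ℝ} {w : ℤ}
    (hw : w ≠ 0) {G : (Fin n → ℂ) → ℂ} (h : HasWeightOnBall m R w G)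
    (hG : DifferentiableOn ℂ G (ball 0 R))
    (hα : ∀ α : Fin n → ℕ, ((∑ j, m j * α j : ℕ) : ℤ) = w → ∑ j, α j ≤ 1) {z : Fin n → ℂ}
    (hz : z ∈ ball 0 R) : G z = fderiv ℂ G 0 z := by
  have hR := pos_of_mem_ball hz
  -- Second partials vanish: a monomial of weight w - m_k - m_j, multiplied by z_k z_j, would have
  -- weight w and degree at least 2.
  have h2 : ∀ k, ∀ y ∈ ball (0 : Fin n → ℂ) R,
      fderiv ℂ G y (Pi.single k 1) = fderiv ℂ G 0 (Pi.single k 1) := by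
    intro k y hy
    have hdk := differentiableOn_fderiv_apply isOpen_ball hG (Pi.single k 1)
    refine eq_apply_zero_of_fderiv_single_eq_zero hdk (fun j x hx => ?_) hy
    refine ((h.fderiv_single hG k).fderiv_single hdk j).eq_zero hm
      (differentiableOn_fderiv_apply isOpen_ball hdk _) (fun α hαj => ?_) hx
    have := hα (α + Pi.single k 1 + Pi.single j 1) (by
      simp only [Pi.add_apply, mul_add, Finset.sum_add_distrib]
      push_cast at hαj ⊢
      rw [hαj]
      simp [Pi.single_apply]
      ring)
    simp [Finset.sum_add_distrib] at this
  have hd : ∀ y ∈ ball (0 : Fin n → ℂ) R,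
      HasFDerivAt (fun z => G z - fderiv ℂ G 0 z) (fderiv ℂ G y - fderiv ℂ G 0) y := fun y hy =>
    (hG.differentiableAt (isOpen_ball.mem_nhds hy)).hasFDerivAt.sub
      (fderiv ℂ G 0).hasFDerivAt
  have h3 := eq_apply_zero_of_fderiv_single_eq_zero (G := fun z => G z - fderiv ℂ G 0 z)
    (fun y hy => (hd y hy).differentiableAt.differentiableWithinAt)
    (fun j y hy => by simp [(hd y hy).fderiv, h2 j y hy]) hz
  have h4 : G 0 = 0 := eq_zero_of_forall_exp_mul hw fun θ => by
    have := h θ 0 (mem_ball_self hR)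
    rwa [rotation_zero_right] at this
  simpa [h4, sub_eq_zero] using h3

/-! ### Averaging over the circle action -/

theorem periodic_exp_I_mul_mul (k : ℤ) :
    Function.Periodic (fun θ : ℝ => Complex.exp (Complex.I * (k : ℂ) * (θ : ℂ)))
      (2 * Real.pi) := by
  intro θ
  refine Complex.exp_eq_exp_iff_exists_int.2 ⟨k, ?_⟩
  push_cast
  ring

theorem periodic_rotation {n : ℕ} (m : Fin n → ℕ) (z : Fin n → ℂ) :
    Function.Periodic (fun θ => rotation m θ z) (2 * Real.pi) := by
  intro θ
  ext j
  have := periodic_exp_I_mul_mul (m j) θ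
  simp only [Int.cast_natCast] at this
  simp only [rotation, this]

/-- If all resonant monomials have degree one, then the average of `σ` over the circle action
depends only on the derivative of `σ` at the origin. -/
theorem integral_rotation_neg_apply {n : ℕ} {m : Fin n → ℕ} {D : Set (Fin n → ℂ)}
    (hD : IsQuasiCircularDomain m D) (h0 : (0 : Fin n → ℂ) ∈ D)
    (hα : ∀ i, ∀ α ∈ resonanceSetAt m i, ∑ j, α j ≤ 1)
    {σ : (Fin n → ℂ) → (Fin n → ℂ)} (hσ : DifferentiableOn ℂ σ D)
    (hσ' : HasFDerivAt σ (ContinuousLinearMap.id ℂ (Fin n → ℂ)) 0)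
    {z : Fin n → ℂ} (hz : z ∈ D) (i : Fin n) :
    ∫ θ in (0 : ℝ)..(2 * Real.pi), rotation m (-θ) (σ (rotation m θ z)) i =
      (2 * Real.pi : ℂ) * z i := by
  set c : ℝ → ℂ := fun θ => Complex.exp (Complex.I * (m i : ℂ) * ((-θ : ℝ) : ℂ)) with hc_def
  have hc : Continuous c := by fun_prop
  set f : (Fin n → ℂ) → ℂ := fun z => σ z i
  have hf : DifferentiableOn ℂ f D := fun z hz => differentiableWithinAt_pi.1 (hσ z hz) i
  have hf0 : fderiv ℂ f 0 = ContinuousLinearMap.proj i :=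
    (hasFDerivAt_pi'.1 hσ' i).fderiv
  set F : (Fin n → ℂ) → ℂ := fun z => ∫ θ in (0 : ℝ)..(2 * Real.pi), c θ * f (rotation m θ z)
  have hFd : ∀ z ∈ D, HasFDerivAt F (∫ θ in (0 : ℝ)..(2 * Real.pi),
      c θ • (fderiv ℂ f (rotation m θ z)).comp (rotationCLM m θ)) z := by
    intro z hz
    have := hasFDerivAt_integral_comp_affine hD.isOpen hf hc (continuous_rotationCLM m)
      (p := fun _ => 0) continuous_const 0 (2 * Real.pi) z
      (fun θ _ => by simpa [rotationCLM_apply] using hD.rotation_mem θ z hz)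
    simpa only [add_zero, rotationCLM_apply] using this
  have hF : DifferentiableOn ℂ F D := fun z hz =>
    (hFd z hz).differentiableAt.differentiableWithinAt
  -- At the origin σ has derivative id, so the two opposite rotations cancel and the integrand is
  -- constant in θ.
  have hF0 : fderiv ℂ F 0 = (2 * Real.pi : ℂ) • ContinuousLinearMap.proj i := by
    rw [(hFd 0 h0).fderiv]
    have : ∀ θ : ℝ, c θ • (fderiv ℂ f (rotation m θ 0)).comp (rotationCLM m θ) =
        ContinuousLinearMap.proj i := by
      intro θ
      ext v
      rw [rotation_zero_right, hf0]
      simpa [rotation, rotationCLM_apply, c] using congrFun (rotation_neg_rotation m θ v) i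
    simp only [this, intervalIntegral.integral_const, sub_zero]
    ext v
    simp
  obtain ⟨R, hR, hsub⟩ := Metric.isOpen_iff.1 hD.isOpen 0 h0
  -- Translating θ by φ extracts the factor e^{i m_i φ}; periodicity makes the shifted interval
  -- irrelevant.
  have hw : HasWeightOnBall m R (m i) F := by
    intro φ z _
    set u : ℝ → ℂ := fun θ => c θ * f (rotation m θ z) with hu_def
    have hu : Function.Periodic u (2 * Real.pi) := by
      intro θ
      have h1 := periodic_exp_I_mul_mul (-(m i : ℤ)) θ
      have h2 : ∀ θ : ℝ,
          Complex.exp (Complex.I * ((-(m i : ℤ) : ℤ) : ℂ) * (θ : ℂ)) = c θ := by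
        intro θ
        simp only [hc_def]
        congr 1
        push_cast
        ring
      simp only [h2] at h1
      simp only [hu_def, h1, periodic_rotation m z θ]
    have h1 : ∀ θ : ℝ, c θ * f (rotation m θ (rotation m φ z)) =
        Complex.exp (Complex.I * ((m i : ℤ) : ℂ) * (φ : ℂ)) * u (θ + φ) := by
      intro θ
      rw [rotation_rotation, hu_def, ← mul_assoc, add_comm φ θ]
      congr 1
      simp only [hc_def, ← Complex.exp_add]
      congr 1
      push_cast
      ring
    simp only [F, h1, intervalIntegral.integral_const_mul]
    congr 1
    rw [intervalIntegral.integral_comp_add_right u φ, zero_add, add_comm (2 * Real.pi) φ,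
      hu.intervalIntegral_add_eq φ 0, zero_add]
  -- The weight argument works only on a ball about 0; the identity theorem extends the equality to
  -- D.
  have hzero : EqOn (fun z => F z - (2 * Real.pi : ℂ) * z i) 0 D := by
    refine eqOn_zero_of_eventuallyEq_zero hD.isOpen hD.isConnected.isPreconnected
      (hF.sub (by fun_prop)) h0 ?_
    filter_upwards [ball_mem_nhds (0 : Fin n → ℂ) hR] with y hy
    have := hw.eq_fderiv hD.weight_pos (by exact_mod_cast (hD.weight_pos i).ne') (hF.mono hsub)
      (fun α h => hα i α (by exact_mod_cast h)) hy
    simp [this, hF0]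
  exact sub_eq_zero.1 (hzero hz)

/-! ### The isotropy group of the origin -/

/-- `g` is an automorphism of `D` with inverse `g'`, and both fix the origin. -/
structure IsIsotropyPair {n : ℕ} (D : Set (Fin n → ℂ)) (g g' : (Fin n → ℂ) → (Fin n → ℂ)) :
    Prop where
  diff : DifferentiableOn ℂ g D
  diff_inv : DifferentiableOn ℂ g' D
  maps : MapsTo g D D
  maps_inv : MapsTo g' D D
  inv : InvOn g' g D D
  map_zero : g 0 = 0
  inv_map_zero : g' 0 = 0

namespace IsIsotropyPair

variable {n : ℕ} {D : Set (Fin n → ℂ)} {g g' h h' : (Fin n → ℂ) → (Fin n → ℂ)}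

theorem symm (hg : IsIsotropyPair D g g') : IsIsotropyPair D g' g :=
  ⟨hg.diff_inv, hg.diff, hg.maps_inv, hg.maps, hg.inv.symm, hg.inv_map_zero, hg.map_zero⟩

theorem comp (hh : IsIsotropyPair D h h') (hg : IsIsotropyPair D g g') :
    IsIsotropyPair D (h ∘ g) (g' ∘ h') where
  diff := hh.diff.comp hg.diff hg.maps
  diff_inv := hg.diff_inv.comp hh.diff_inv hh.maps_inv
  maps := hh.maps.comp hg.maps
  maps_inv := hg.maps_inv.comp hh.maps_inv
  inv := hg.inv.comp hh.inv hg.maps hh.maps_inv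
  map_zero := by simp [hg.map_zero, hh.map_zero]
  inv_map_zero := by simp [hg.inv_map_zero, hh.inv_map_zero]

theorem hasFDerivAt (hD : IsOpen D) (h0 : (0 : Fin n → ℂ) ∈ D) (hg : IsIsotropyPair D g g') :
    HasFDerivAt g (fderiv ℂ g 0) 0 :=
  (hg.diff.differentiableAt (hD.mem_nhds h0)).hasFDerivAt

theorem fderiv_inv_comp (hD : IsOpen D) (h0 : (0 : Fin n → ℂ) ∈ D)
    (hh : IsIsotropyPair D h h') (hg : IsIsotropyPair D g g') :
    fderiv ℂ (g' ∘ h') 0 = (fderiv ℂ g' 0).comp (fderiv ℂ h' 0) := by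
  have h1 : HasFDerivAt g' (fderiv ℂ g' 0) (h' 0) := by
    rw [hh.inv_map_zero]; exact hg.symm.hasFDerivAt hD h0
  exact (h1.comp 0 (hh.symm.hasFDerivAt hD h0)).fderiv

theorem fderiv_comp_fderiv_inv (hD : IsOpen D) (h0 : (0 : Fin n → ℂ) ∈ D)
    (hg : IsIsotropyPair D g g') :
    (fderiv ℂ g 0).comp (fderiv ℂ g' 0) = ContinuousLinearMap.id ℂ (Fin n → ℂ) := by
  have h1 : HasFDerivAt g (fderiv ℂ g 0) (g' 0) := by
    rw [hg.inv_map_zero]; exact hg.hasFDerivAt hD h0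
  refine (h1.comp 0 (hg.symm.hasFDerivAt hD h0)).unique ?_
  refine (hasFDerivAt_id (𝕜 := ℂ) (0 : Fin n → ℂ)).congr_of_eventuallyEq ?_
  filter_upwards [hD.mem_nhds h0] with z hz using hg.inv.2 hz

/-- The members of the isotropy group of the origin in a bounded domain are equi-Lipschitz near
the origin. -/
theorem exists_lipschitz_bound (hb : Bornology.IsBounded D) {R : ℝ} (hR : 0 < R)
    (hsub : ball 0 R ⊆ D) : ∃ K : ℝ, 0 < K ∧ ∀ g g' : (Fin n → ℂ) → (Fin n → ℂ),
      IsIsotropyPair D g g' → ‖fderiv ℂ g 0‖ ≤ K ∧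
        ∀ x ∈ ball 0 (R / 2), ∀ y ∈ ball 0 (R / 2), ‖g x - g y‖ ≤ K * ‖x - y‖ := by
  obtain ⟨M, hM0, hM⟩ := hb.exists_pos_norm_le
  -- Cauchy estimate on balls of radius R/2, where g varies by at most 2M; the constant depends on D
  -- only through M and R.
  refine ⟨2 * M / (R / 2), by positivity, fun g g' hg => ?_⟩
  have hsub' : ∀ x ∈ ball (0 : Fin n → ℂ) (R / 2), ball x (R / 2) ⊆ D := fun x hx y hy => by
    refine hsub ?_
    have := dist_triangle y x 0
    rw [mem_ball] at *; linarith
  have hder : ∀ x ∈ ball (0 : Fin n → ℂ) (R / 2), ‖fderiv ℂ g x‖ ≤ 2 * M / (R / 2) := by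
    intro x hx
    refine Complex.norm_fderiv_le_div_of_mapsTo_ball (hg.diff.mono (hsub' x hx)) (fun y hy => ?_)
      (half_pos hR)
    rw [mem_closedBall, dist_eq_norm]
    have h1 := hM _ (hg.maps (hsub' x hx hy))
    have h2 := hM _ (hg.maps (hsub' x hx (mem_ball_self (half_pos hR))))
    linarith [norm_sub_le (g y) (g x)]
  refine ⟨hder 0 (mem_ball_self (half_pos hR)), fun x hx y hy => ?_⟩
  refine (convex_ball (0 : Fin n → ℂ) (R / 2)).norm_image_sub_le_of_norm_hasFDerivWithin_le
    (𝕜 := ℂ) (f' := fderiv ℂ g) (fun z hz => ?_) hder hy hx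
  exact ((hg.diff _ (hsub' z hz (mem_ball_self (half_pos hR)))).differentiableAt
    (mem_of_superset (ball_mem_nhds z (half_pos hR)) (hsub' z hz))).hasFDerivAt.hasFDerivWithinAt

end IsIsotropyPair

theorem isIsotropyPair_rotation {n : ℕ} {m : Fin n → ℕ} {D : Set (Fin n → ℂ)}
    (hD : IsQuasiCircularDomain m D) (θ : ℝ) :
    IsIsotropyPair D (rotation m θ) (rotation m (-θ)) where
  diff := (rotationCLM m θ).differentiable.differentiableOn
  diff_inv := (rotationCLM m (-θ)).differentiable.differentiableOn
  maps := hD.rotation_mem θ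
  maps_inv := hD.rotation_mem (-θ)
  inv := ⟨fun z _ => rotation_neg_rotation m θ z, fun z _ => by
    simpa using rotation_neg_rotation m (-θ) z⟩
  map_zero := rotation_zero_right m θ
  inv_map_zero := rotation_zero_right m (-θ)

/-! ### The Hermitian norm and Jensen's inequality -/

/-- The square of the Hermitian norm on `ℂⁿ`. -/
noncomputable def normSqSum {n : ℕ} (v : Fin n → ℂ) : ℝ := ∑ i, ‖v i‖ ^ 2

theorem continuous_normSqSum {n : ℕ} : Continuous (normSqSum (n := n)) := by
  unfold normSqSum; fun_prop

theorem normSqSum_nonneg {n : ℕ} (v : Fin n → ℂ) : 0 ≤ normSqSum v :=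
  Finset.sum_nonneg fun _ _ => by positivity

theorem normSqSum_le {n : ℕ} (v : Fin n → ℂ) : normSqSum v ≤ n * ‖v‖ ^ 2 := by
  calc normSqSum v ≤ ∑ _i : Fin n, ‖v‖ ^ 2 := Finset.sum_le_sum fun i _ => by
        gcongr; exact norm_le_pi_norm v i
    _ = n * ‖v‖ ^ 2 := by simp

theorem le_normSqSum {n : ℕ} {v : Fin n → ℂ} {a : ℝ} (ha : 0 ≤ a) (h : a ≤ ‖v‖) :
    a ^ 2 ≤ normSqSum v := by
  have h1 : ‖v‖ ≤ √(normSqSum v) := (pi_norm_le_iff_of_nonneg (Real.sqrt_nonneg _)).2 fun i =>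
    Real.le_sqrt_of_sq_le
      (Finset.single_le_sum (f := fun i => ‖v i‖ ^ 2) (fun _ _ => by positivity)
        (Finset.mem_univ i))
  calc a ^ 2 ≤ √(normSqSum v) ^ 2 := by gcongr; exact h.trans h1
    _ = normSqSum v := Real.sq_sqrt (normSqSum_nonneg v)

theorem normSqSum_midpoint {n : ℕ} (a b : Fin n → ℂ) :
    normSqSum ((1 / 2 : ℂ) • (a + b)) =
      (normSqSum a + normSqSum b) / 2 - normSqSum (b - a) / 4 := by
  simp only [normSqSum, ← Finset.sum_add_distrib, Finset.sum_div, ← Finset.sum_sub_distrib]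
  refine Finset.sum_congr rfl fun i _ => ?_
  have := parallelogram_law_with_norm ℝ (a i) (b i)
  simp only [Pi.smul_apply, Pi.add_apply, Pi.sub_apply, smul_eq_mul, norm_mul,
    norm_sub_rev (b i) (a i)]
  norm_num
  nlinarith

/-- Integrate |w|² ≥ 2 Re(ā w) - |a|², which is |w - a|² ≥ 0. -/
theorem mul_norm_sq_le_integral {w : ℝ → ℂ} (hw : Continuous w) {a : ℂ} {T : ℝ} (hT : 0 ≤ T)
    (h : ∫ θ in (0 : ℝ)..T, w θ = (T : ℂ) * a) :
    T * ‖a‖ ^ 2 ≤ ∫ θ in (0 : ℝ)..T, ‖w θ‖ ^ 2 := by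
  have h1 : ∀ θ, 2 * Complex.reCLM (starRingEnd ℂ a * w θ) - ‖a‖ ^ 2 ≤ ‖w θ‖ ^ 2 := by
    intro θ
    have := sq_nonneg ((w θ).re - a.re)
    have := sq_nonneg ((w θ).im - a.im)
    simp only [Complex.sq_norm, Complex.normSq_apply, Complex.reCLM_apply, Complex.mul_re,
      Complex.conj_re, Complex.conj_im]
    nlinarith
  have h2 : ∫ θ in (0 : ℝ)..T, (2 * Complex.reCLM (starRingEnd ℂ a * w θ) - ‖a‖ ^ 2) =
      T * ‖a‖ ^ 2 := by
    rw [intervalIntegral.integral_sub ((by fun_prop : Continuous _).intervalIntegrable _ _)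
      intervalIntegrable_const, intervalIntegral.integral_const_mul,
      ContinuousLinearMap.intervalIntegral_comp_comm _
        ((by fun_prop : Continuous _).intervalIntegrable _ _),
      intervalIntegral.integral_const_mul, h, intervalIntegral.integral_const]
    simp only [Complex.sq_norm, Complex.normSq_apply, Complex.reCLM_apply, Complex.mul_re,
      Complex.conj_re, Complex.conj_im, Complex.mul_im, Complex.ofReal_re, Complex.ofReal_im,
      smul_eq_mul]
    ring
  rw [← h2]
  exact intervalIntegral.integral_mono_on hT
    ((by fun_prop : Continuous _).intervalIntegrable _ _)
    ((by fun_prop : Continuous _).intervalIntegrable _ _) fun θ _ => h1 θ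

/-- Jensen's inequality for `normSqSum`. -/
theorem mul_normSqSum_le_integral {n : ℕ} {w : ℝ → Fin n → ℂ} (hw : Continuous w)
    {a : Fin n → ℂ} {T : ℝ} (hT : 0 ≤ T)
    (h : ∀ i, ∫ θ in (0 : ℝ)..T, w θ i = (T : ℂ) * a i) :
    T * normSqSum a ≤ ∫ θ in (0 : ℝ)..T, normSqSum (w θ) := by
  simp only [normSqSum]
  rw [intervalIntegral.integral_finsetSum fun i _ =>
    (by fun_prop : Continuous _).intervalIntegrable _ _, Finset.mul_sum]
  exact Finset.sum_le_sum fun i _ => mul_norm_sq_le_integral (by fun_prop) hT (h i)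

theorem integrableOn_normSqSum {n : ℕ} {D : Set (Fin n → ℂ)} (hD : IsOpen D)
    (hb : Bornology.IsBounded D) {u : (Fin n → ℂ) → (Fin n → ℂ)} (hu : ContinuousOn u D) {C : ℝ}
    (hC : ∀ z ∈ D, ‖u z‖ ≤ C) : IntegrableOn (fun z => normSqSum (u z)) D := by
  refine IntegrableOn.of_bound hb.measure_lt_top
    ((continuous_normSqSum.comp_continuousOn hu).aestronglyMeasurable hD.measurableSet)
    (n * C ^ 2) ?_
  filter_upwards [ae_restrict_mem hD.measurableSet] with z hz
  rw [Real.norm_of_nonneg (normSqSum_nonneg _)]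
  refine (normSqSum_le _).trans ?_
  have := hC z hz
  gcongr

/-! ### Energy estimates over the isotropy group -/

/-- The squared `L²` norm over `D` of `σ` transported by the isotropy pair `(g, g')`. -/
noncomputable def energy {n : ℕ} (D : Set (Fin n → ℂ)) (g g' σ : (Fin n → ℂ) → (Fin n → ℂ)) :
    ℝ :=
  ∫ z in D, normSqSum (fderiv ℂ g' 0 (σ (g z)))

theorem IsIsotropyPair.integrableOn_energy {n : ℕ} {D : Set (Fin n → ℂ)} (hD : IsOpen D)
    (hb : Bornology.IsBounded D) {g g' σ : (Fin n → ℂ) → (Fin n → ℂ)}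
    (hg : IsIsotropyPair D g g') (hσ : ContinuousOn σ D) {C : ℝ} (hC : ∀ z ∈ D, ‖σ z‖ ≤ C) :
    IntegrableOn (fun z => normSqSum (fderiv ℂ g' 0 (σ (g z)))) D :=
  integrableOn_normSqSum hD hb (C := ‖fderiv ℂ g' 0‖ * C)
    ((fderiv ℂ g' 0).continuous.comp_continuousOn (hσ.comp hg.diff.continuousOn hg.maps))
    fun _ hz => (ContinuousLinearMap.le_opNorm _ _).trans
      (mul_le_mul_of_nonneg_left (hC _ (hg.maps hz)) (norm_nonneg _))

/-- The parallelogram law for the energy of the midpoint of the identity and `h'(0) ∘ h`. -/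
theorem energy_midpoint {n : ℕ} {D : Set (Fin n → ℂ)} (hD : IsOpen D)
    (hb : Bornology.IsBounded D) (h0 : (0 : Fin n → ℂ) ∈ D)
    {g g' h h' : (Fin n → ℂ) → (Fin n → ℂ)}
    (hg : IsIsotropyPair D g g') (hh : IsIsotropyPair D h h') :
    energy D g g' (fun z => (1 / 2 : ℂ) • (z + fderiv ℂ h' 0 (h z))) =
      (energy D g g' id + energy D (h ∘ g) (g' ∘ h') id) / 2 -
        energy D g g' (fun z => fderiv ℂ h' 0 (h z) - z) / 4 := by
  obtain ⟨M, hM⟩ := hb.exists_norm_le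
  have hσ : ContinuousOn (fun z => fderiv ℂ h' 0 (h z)) D :=
    (fderiv ℂ h' 0).continuous.comp_continuousOn hh.diff.continuousOn
  have hσM : ∀ z ∈ D, ‖fderiv ℂ h' 0 (h z)‖ ≤ ‖fderiv ℂ h' 0‖ * M := fun z hz =>
    (ContinuousLinearMap.le_opNorm _ _).trans
      (mul_le_mul_of_nonneg_left (hM _ (hh.maps hz)) (norm_nonneg _))
  have i1 := hg.integrableOn_energy hD hb continuousOn_id hM
  have i2 := (hh.comp hg).integrableOn_energy hD hb continuousOn_id hM
  have i3 := hg.integrableOn_energy hD hb (σ := fun z => fderiv ℂ h' 0 (h z) - z)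
    (hσ.sub continuousOn_id)
    (fun z hz => (norm_sub_le _ _).trans (add_le_add (hσM z hz) (hM z hz)))
  simp only [energy]
  rw [← integral_add i1 i2, ← integral_div, ← integral_div,
    ← integral_sub (by exact (i1.add i2).div_const 2) (by exact i3.div_const 4)]
  refine integral_congr_ae (Eventually.of_forall fun z => ?_)
  -- By the chain rule, transporting dh'(0) ∘ h by (g, g') is the same as transporting the identity
  -- by (h ∘ g, g' ∘ h').
  simp only [hh.fderiv_inv_comp hD h0 hg, map_smul, map_add, map_sub, normSqSum_midpoint,
    ContinuousLinearMap.comp_apply, Function.comp_apply, id]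

/-- The energy of a nonzero holomorphic map is bounded below, uniformly over the isotropy group. -/
theorem exists_pos_le_energy {n : ℕ} {D : Set (Fin n → ℂ)} (hD : IsOpen D)
    (hc : IsPreconnected D) (hb : Bornology.IsBounded D) (h0 : (0 : Fin n → ℂ) ∈ D)
    {τ : (Fin n → ℂ) → (Fin n → ℂ)} (hτ : DifferentiableOn ℂ τ D) {C : ℝ}
    (hC : ∀ z ∈ D, ‖τ z‖ ≤ C) (hne : ¬ EqOn τ 0 D) :
    ∃ η : ℝ, 0 < η ∧ ∀ g g' : (Fin n → ℂ) → (Fin n → ℂ), IsIsotropyPair D g g' →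
      η ≤ energy D g g' τ := by
  obtain ⟨R, hR, hsub⟩ := Metric.isOpen_iff.1 hD 0 h0
  obtain ⟨K, hK, hLip⟩ := IsIsotropyPair.exists_lipschitz_bound hb hR hsub
  have hfreq : ∃ᶠ z in 𝓝 (0 : Fin n → ℂ), τ z ≠ 0 := fun hev =>
    hne (eqOn_zero_of_eventuallyEq_zero hD hc hτ h0 (hev.mono fun z hz => not_not.1 hz))
  -- The point z₀ is so close to 0 that ‖g' z₀‖ ≤ K‖z₀‖ < R/4 for every g in the group.
  obtain ⟨z₀, hz₀, hz₀b⟩ := (hfreq.and_eventually (ball_mem_nhds (0 : Fin n → ℂ)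
    (by positivity : 0 < min (R / 2) (R / (4 * K))))).exists
  rw [dist_zero_right, lt_min_iff, lt_div_iff₀ (by positivity : 0 < 4 * K)] at hz₀b
  have hz₀R : z₀ ∈ ball (0 : Fin n → ℂ) (R / 2) := mem_ball_zero_iff.2 hz₀b.1
  have hz₀D : z₀ ∈ D := hsub (ball_subset_ball (by linarith) hz₀R)
  have hδ : 0 < ‖τ z₀‖ / 2 := by positivity
  obtain ⟨ε, hε, hτε⟩ := Metric.eventually_nhds_iff_ball.1
    ((hτ.differentiableAt (hD.mem_nhds hz₀D)).continuousAt.norm.eventually_const_lt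
      (half_lt_self (norm_pos_iff.2 hz₀)))
  -- The ball of radius r about g' z₀ stays in `ball 0 (R / 2)` and is mapped by g into `ball z₀ ε`,
  -- where ‖τ‖ > ‖τ z₀‖/2. Since dg(0) has norm at most K, its inverse dg'(0) shrinks vectors by at
  -- most the factor K. Only the centre of the ball depends on g, so its volume does not.
  set r := min (R / 4) (ε / K)
  have hr : 0 < r := by positivity
  refine ⟨volume.real (ball (0 : Fin n → ℂ) r) * (‖τ z₀‖ / 2 / K) ^ 2,
    mul_pos (ENNReal.toReal_pos (measure_ball_pos _ _ hr).ne' measure_ball_lt_top.ne)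
      (by positivity), fun g g' hg => ?_⟩
  have hy : ‖g' z₀‖ < R / 4 := by
    have := (hLip g' g hg.symm).2 z₀ hz₀R 0 (mem_ball_self (half_pos hR))
    rw [hg.inv_map_zero, sub_zero, sub_zero] at this
    linarith
  have hballR : ball (g' z₀) r ⊆ ball 0 (R / 2) := fun x hx => by
    have h1 := mem_ball.1 hx
    have h2 := dist_triangle x (g' z₀) 0
    have h3 : r ≤ R / 4 := min_le_left _ _
    rw [dist_zero_right (g' z₀)] at h2
    rw [mem_ball]; linarith
  have hballD : ball (g' z₀) r ⊆ D := (hballR.trans (ball_subset_ball (by linarith))).trans hsub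
  have hlow : ∀ x ∈ ball (g' z₀) r,
      (‖τ z₀‖ / 2 / K) ^ 2 ≤ normSqSum (fderiv ℂ g' 0 (τ (g x))) := by
    intro x hx
    refine le_normSqSum (by positivity) ?_
    have h1 := (hLip g g' hg).2 x (hballR hx) (g' z₀) (hballR (mem_ball_self hr))
    rw [hg.inv.2 hz₀D] at h1
    have h2 : ‖x - g' z₀‖ < ε / K := (mem_ball_iff_norm.1 hx).trans_le (min_le_right _ _)
    rw [lt_div_iff₀ hK] at h2
    have h3 : g x ∈ ball z₀ ε := by rw [mem_ball_iff_norm]; linarith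
    have h4 := hτε _ h3
    have h5 : ‖τ (g x)‖ ≤ K * ‖fderiv ℂ g' 0 (τ (g x))‖ := by
      have h6 := DFunLike.congr_fun (hg.fderiv_comp_fderiv_inv hD h0) (τ (g x))
      simp only [ContinuousLinearMap.comp_apply, ContinuousLinearMap.id_apply] at h6
      calc ‖τ (g x)‖ = ‖fderiv ℂ g 0 (fderiv ℂ g' 0 (τ (g x)))‖ := by rw [h6]
        _ ≤ ‖fderiv ℂ g 0‖ * ‖fderiv ℂ g' 0 (τ (g x))‖ := ContinuousLinearMap.le_opNorm _ _
        _ ≤ K * ‖fderiv ℂ g' 0 (τ (g x))‖ := by gcongr; exact (hLip g g' hg).1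
    rw [div_le_iff₀ hK]
    linarith
  have hint := hg.integrableOn_energy hD hb hτ.continuousOn hC
  calc volume.real (ball (0 : Fin n → ℂ) r) * (‖τ z₀‖ / 2 / K) ^ 2
      = ∫ _z in ball (g' z₀) r, (‖τ z₀‖ / 2 / K) ^ 2 := by
        rw [setIntegral_const, smul_eq_mul, Measure.real, Measure.real,
          Measure.addHaar_ball_center volume (g' z₀) r]
    _ ≤ ∫ z in ball (g' z₀) r, normSqSum (fderiv ℂ g' 0 (τ (g z))) :=
        setIntegral_mono_on (integrableOn_const measure_ball_lt_top.ne)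
          (hint.mono_set hballD) measurableSet_ball hlow
    _ ≤ energy D g g' τ :=
        setIntegral_mono_set hint (Eventually.of_forall fun _ => normSqSum_nonneg _)
          (LE.le.eventuallyLE hballD)

/-- If all resonant monomials have degree one, the energy of the identity is at most the supremum over
the circle action of the energy of any bounded holomorphic map tangent to it at the origin. -/
theorem energy_id_le {n : ℕ} {m : Fin n → ℕ} {D : Set (Fin n → ℂ)}
    (hD : IsQuasiCircularDomain m D) (hb : Bornology.IsBounded D) (h0 : (0 : Fin n → ℂ) ∈ D)
    (hα : ∀ i, ∀ α ∈ resonanceSetAt m i, ∑ j, α j ≤ 1)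
    {σ : (Fin n → ℂ) → (Fin n → ℂ)} (hσ : DifferentiableOn ℂ σ D)
    (hσ' : HasFDerivAt σ (ContinuousLinearMap.id ℂ (Fin n → ℂ)) 0) {C : ℝ}
    (hC : ∀ z ∈ D, ‖σ z‖ ≤ C) {g g' : (Fin n → ℂ) → (Fin n → ℂ)} (hg : IsIsotropyPair D g g')
    {b : ℝ} (hle : ∀ θ, energy D (rotation m θ ∘ g) (g' ∘ rotation m (-θ)) σ ≤ b) :
    energy D g g' id ≤ b := by
  have hT : (0 : ℝ) < 2 * Real.pi := Real.two_pi_pos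
  set B := fderiv ℂ g' 0
  set Q : (Fin n → ℂ) → ℝ → ℝ := fun z θ =>
    normSqSum (B (rotation m (-θ) (σ (rotation m θ (g z))))) with hQ_def
  have hrot : Continuous fun p : ℝ × (Fin n → ℂ) => rotation m p.1 p.2 := by
    refine continuous_pi fun j => ?_
    simp only [rotation]
    fun_prop
  have hwcont : ∀ y ∈ D, Continuous fun θ : ℝ => rotation m (-θ) (σ (rotation m θ y)) := by
    intro y hy
    have h1 : Continuous fun θ : ℝ => σ (rotation m θ y) :=
      hσ.continuousOn.comp_continuous (hrot.comp (by fun_prop : Continuous fun θ : ℝ => (θ, y)))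
        fun θ => hD.rotation_mem θ y hy
    exact hrot.comp (continuous_neg.prodMk h1)
  -- The averaging identity at g z: the circle mean of the vectors inside B is g z itself.
  have hjensen : ∀ z ∈ D, 2 * Real.pi * normSqSum (B (g z)) ≤
      ∫ θ in (0 : ℝ)..(2 * Real.pi), Q z θ := by
    intro z hz
    have hw := hwcont (g z) (hg.maps hz)
    refine mul_normSqSum_le_integral (B.continuous.comp hw) hT.le fun i => ?_
    have h1 : ∫ θ in (0 : ℝ)..(2 * Real.pi), rotation m (-θ) (σ (rotation m θ (g z))) =
        ((2 * Real.pi : ℝ) : ℂ) • g z := by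
      ext k
      have h2 := (ContinuousLinearMap.proj (R := ℂ) (φ := fun _ : Fin n => ℂ)
        k).intervalIntegral_comp_comm (hw.intervalIntegrable (μ := volume) 0 (2 * Real.pi))
      simp only [ContinuousLinearMap.proj_apply] at h2
      rw [← h2, integral_rotation_neg_apply hD h0 hα hσ hσ' (hg.maps hz) k]
      simp
    have h3 := ((ContinuousLinearMap.proj (R := ℂ) (φ := fun _ : Fin n => ℂ) i).comp
      B).intervalIntegral_comp_comm (hw.intervalIntegrable (μ := volume) 0 (2 * Real.pi))
    rw [h1] at h3
    simpa using h3
  have hQint : Integrable (Function.uncurry Q)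
      ((volume.restrict D).prod (volume.restrict (Ioc 0 (2 * Real.pi)))) := by
    rw [Measure.prod_restrict]
    have hcont : ContinuousOn (Function.uncurry Q) (D ×ˢ Ioc 0 (2 * Real.pi)) := by
      have h1 : ContinuousOn (fun p : (Fin n → ℂ) × ℝ => rotation m p.2 (g p.1))
          (D ×ˢ Ioc 0 (2 * Real.pi)) :=
        hrot.comp_continuousOn (continuousOn_snd.prodMk
          (hg.diff.continuousOn.comp continuousOn_fst fun p hp => hp.1))
      have h2 : ContinuousOn (fun p : (Fin n → ℂ) × ℝ => σ (rotation m p.2 (g p.1)))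
          (D ×ˢ Ioc 0 (2 * Real.pi)) :=
        hσ.continuousOn.comp h1 fun p hp => hD.rotation_mem _ _ (hg.maps hp.1)
      exact (continuous_normSqSum.comp B.continuous).comp_continuousOn
        (hrot.comp_continuousOn (continuousOn_snd.neg.prodMk h2))
    refine IntegrableOn.of_bound ?_ (hcont.aestronglyMeasurable
      (hD.isOpen.measurableSet.prod measurableSet_Ioc)) (n * (‖B‖ * C) ^ 2) ?_
    · rw [Measure.prod_prod]
      exact ENNReal.mul_lt_top hb.measure_lt_top measure_Ioc_lt_top
    · filter_upwards [ae_restrict_mem (hD.isOpen.measurableSet.prod measurableSet_Ioc)] with p hp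
      simp only [Function.uncurry, hQ_def]
      rw [Real.norm_of_nonneg (normSqSum_nonneg _)]
      refine (normSqSum_le _).trans ?_
      have h1 : ‖B (rotation m (-p.2) (σ (rotation m p.2 (g p.1))))‖ ≤ ‖B‖ * C := by
        refine (B.le_opNorm _).trans (mul_le_mul_of_nonneg_left ?_ (norm_nonneg _))
        rw [norm_rotation]
        exact hC _ (hD.rotation_mem _ _ (hg.maps hp.1))
      gcongr
  have henergy : ∀ θ, ∫ z in D, Q z θ =
      energy D (rotation m θ ∘ g) (g' ∘ rotation m (-θ)) σ := by
    intro θ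
    have h1 : fderiv ℂ (rotation m (-θ)) 0 = rotationCLM m (-θ) := (rotationCLM m (-θ)).fderiv
    simp only [energy, (isIsotropyPair_rotation hD θ).fderiv_inv_comp hD.isOpen h0 hg, h1]
    rfl
  have hswap := integral_integral_swap hQint
  obtain ⟨M, hM⟩ := hb.exists_norm_le
  have i1 := hg.integrableOn_energy hD.isOpen hb continuousOn_id hM
  -- Integrate the pointwise inequality over D and exchange the integrals; for fixed θ the inner one
  -- is the energy for ρ_θ ∘ g.
  have hmul : 2 * Real.pi * energy D g g' id ≤ 2 * Real.pi * b := by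
    calc 2 * Real.pi * energy D g g' id
        = ∫ z in D, 2 * Real.pi * normSqSum (B (g z)) := by
          rw [integral_const_mul]; rfl
      _ ≤ ∫ z in D, ∫ θ in Ioc 0 (2 * Real.pi), Q z θ := by
          refine setIntegral_mono_on (i1.const_mul _) hQint.integral_prod_left
            hD.isOpen.measurableSet fun z hz => ?_
          rw [← intervalIntegral.integral_of_le hT.le]
          exact hjensen z hz
      _ = ∫ θ in Ioc 0 (2 * Real.pi), ∫ z in D, Q z θ := hswap
      _ ≤ ∫ _θ in Ioc 0 (2 * Real.pi), b := by
          refine setIntegral_mono_on hQint.integral_prod_right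
            (integrableOn_const measure_Ioc_lt_top.ne) measurableSet_Ioc fun θ _ => ?_
          rw [henergy]
          exact hle θ
      _ = 2 * Real.pi * b := by
          rw [setIntegral_const]
          simp [hT.le]
  exact le_of_mul_le_mul_left hmul hT

/-! ### Linearity of the isotropy group -/

/-- If all resonant monomials have degree one, an automorphism of a bounded quasi-circular domain
which fixes the origin agrees with its derivative at the origin. -/
theorem IsIsotropyPair.eqOn_fderiv {n : ℕ} {m : Fin n → ℕ} {D : Set (Fin n → ℂ)}
    (hD : IsQuasiCircularDomain m D) (hb : Bornology.IsBounded D) (h0 : (0 : Fin n → ℂ) ∈ D)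
    (hα : ∀ i, ∀ α ∈ resonanceSetAt m i, ∑ j, α j ≤ 1)
    {h h' : (Fin n → ℂ) → (Fin n → ℂ)} (hh : IsIsotropyPair D h h') :
    EqOn h (fderiv ℂ h 0) D := by
  obtain ⟨M, hM0, hM⟩ := hb.exists_pos_norm_le
  set B := fderiv ℂ h' 0
  have hBA : (fderiv ℂ h' 0).comp (fderiv ℂ h 0) = ContinuousLinearMap.id ℂ (Fin n → ℂ) :=
    hh.symm.fderiv_comp_fderiv_inv hD.isOpen h0
  have hAB := hh.fderiv_comp_fderiv_inv hD.isOpen h0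
  have hσd : DifferentiableOn ℂ (fun z => B (h z)) D :=
    B.differentiable.comp_differentiableOn hh.diff
  have hσM : ∀ z ∈ D, ‖B (h z)‖ ≤ ‖B‖ * M := fun z hz =>
    (B.le_opNorm _).trans (mul_le_mul_of_nonneg_left (hM _ (hh.maps hz)) (norm_nonneg _))
  have hzero : EqOn (fun z => B (h z) - z) 0 D := by
    by_contra hne
    obtain ⟨η, hη, hlow⟩ := exists_pos_le_energy hD.isOpen hD.isConnected.isPreconnected hb h0
      (τ := fun z => B (h z) - z) (hσd.sub differentiableOn_id)
      (fun z hz => (norm_sub_le _ _).trans (add_le_add (hσM z hz) (hM z hz))) hne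
    have hmid : DifferentiableOn ℂ (fun z => (1 / 2 : ℂ) • (z + B (h z))) D :=
      (differentiableOn_id.add hσd).const_smul (1 / 2 : ℂ)
    have hmid' : HasFDerivAt (fun z => (1 / 2 : ℂ) • (z + B (h z)))
        (ContinuousLinearMap.id ℂ (Fin n → ℂ)) 0 := by
      have h1 : HasFDerivAt (fun z => B (h z)) (ContinuousLinearMap.id ℂ (Fin n → ℂ)) 0 := by
        rw [← hBA]
        exact HasFDerivAt.comp 0 B.hasFDerivAt (hh.hasFDerivAt hD.isOpen h0)
      refine (((hasFDerivAt_id (𝕜 := ℂ) (0 : Fin n → ℂ)).add h1).const_smul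
        (1 / 2 : ℂ)).congr_fderiv ?_
      rw [← two_smul ℂ, smul_smul]
      norm_num
    have hmidM : ∀ z ∈ D, ‖(1 / 2 : ℂ) • (z + B (h z))‖ ≤ ‖(1 / 2 : ℂ)‖ * (M + ‖B‖ * M) :=
      fun z hz => by
        rw [norm_smul]
        exact mul_le_mul_of_nonneg_left
          ((norm_add_le _ _).trans (add_le_add (hM z hz) (hσM z hz))) (norm_nonneg _)
    -- The supremum of S need not be attained: the gap η/4 is uniform over the group, so no
    -- compactness is needed.
    set S : Set ℝ := {e | ∃ g g', IsIsotropyPair D g g' ∧ e = energy D g g' id}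
    have hSne : S.Nonempty := ⟨_, h, h', hh, rfl⟩
    have hSb : BddAbove S := by
      obtain ⟨R, hR, hsub⟩ := Metric.isOpen_iff.1 hD.isOpen 0 h0
      obtain ⟨K, hK, hLip⟩ := IsIsotropyPair.exists_lipschitz_bound hb hR hsub
      refine ⟨∫ _z in D, n * (K * M) ^ 2, ?_⟩
      rintro _ ⟨g, g', hg, rfl⟩
      refine setIntegral_mono_on (hg.integrableOn_energy hD.isOpen hb continuousOn_id hM)
        (integrableOn_const hb.measure_lt_top.ne) hD.isOpen.measurableSet fun z hz => ?_
      refine (normSqSum_le _).trans ?_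
      have h1 : ‖fderiv ℂ g' 0 (g z)‖ ≤ K * M :=
        (ContinuousLinearMap.le_opNorm _ _).trans (mul_le_mul (hLip g' g hg.symm).1
          (hM _ (hg.maps hz)) (norm_nonneg _) hK.le)
      simp only [id]
      gcongr
    have hmidle : ∀ g g', IsIsotropyPair D g g' →
        energy D g g' (fun z => (1 / 2 : ℂ) • (z + B (h z))) ≤ sSup S - η / 4 := by
      intro g g' hg
      rw [energy_midpoint hD.isOpen hb h0 hg hh]
      have h1 := le_csSup hSb ⟨g, g', hg, rfl⟩
      have h2 := le_csSup hSb ⟨_, _, hh.comp hg, rfl⟩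
      have h3 : η ≤ energy D g g' fun z => fderiv ℂ h' 0 (h z) - z := hlow g g' hg
      linarith
    -- The midpoint bound applies to ρ_θ ∘ g for every θ, since the rotations belong to the isotropy
    -- group.
    have hsup : sSup S ≤ sSup S - η / 4 := by
      refine csSup_le hSne ?_
      rintro _ ⟨g, g', hg, rfl⟩
      exact energy_id_le hD hb h0 hα hmid hmid' hmidM hg fun θ =>
        hmidle _ _ ((isIsotropyPair_rotation hD θ).comp hg)
    linarith
  intro z hz
  have h1 : B (h z) = z := sub_eq_zero.1 (hzero hz)
  have h2 := DFunLike.congr_fun hAB (h z)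
  simp only [ContinuousLinearMap.comp_apply, ContinuousLinearMap.id_apply] at h2
  calc h z = fderiv ℂ h 0 (B (h z)) := h2.symm
    _ = fderiv ℂ h 0 z := by rw [h1]

/-! ### Weights of resonance order one -/

theorem sum_le_one_of_resonanceOrder_eq_one {n : ℕ} {m : Fin n → ℕ} (hm : ∀ j, 0 < m j)
    (h : resonanceOrder m = 1) (i : Fin n) {α : Fin n → ℕ} (hα : α ∈ resonanceSetAt m i) :
    ∑ j, α j ≤ 1 :=
  h ▸ (isGreatest_resonanceOrder (Fin.pos i) m hm).2 ⟨α, mem_iUnion.2 ⟨i, hα⟩, rfl⟩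

theorem resonanceOrder_eq_one {n : ℕ} (hn : 0 < n) {m : Fin n → ℕ} (hm : ∀ j, 0 < m j)
    (h : ∀ i, ∀ α ∈ resonanceSetAt m i, ∑ j, α j ≤ 1) : resonanceOrder m = 1 := by
  refine (isGreatest_resonanceOrder hn m hm).unique ⟨?_, ?_⟩
  · refine ⟨Pi.single ⟨0, hn⟩ 1, mem_iUnion.2 ⟨⟨0, hn⟩, ?_⟩, by simp⟩
    simp [resonanceSetAt, Pi.single_apply]
  · rintro _ ⟨α, hα, rfl⟩
    obtain ⟨i, hi⟩ := mem_iUnion.1 hα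
    exact h i α hi

theorem resonanceOrder_eq_one_of_forall_eq {n : ℕ} (hn : 0 < n) {m : Fin n → ℕ}
    (hm : ∀ j, 0 < m j) (h : ∀ i j, m i = m j) : resonanceOrder m = 1 := by
  refine resonanceOrder_eq_one hn hm fun i α hα => ?_
  have h1 : m i * ∑ j, α j = m i * 1 := by
    rw [Finset.mul_sum, mul_one]
    refine Eq.trans (Finset.sum_congr rfl fun j _ => ?_) hα
    rw [h i j]
  exact (Nat.eq_of_mul_eq_mul_left (hm i) h1).le

/-- Coprimality and m_1 ≥ 2 force m_1 < m_2 and m_1 ∤ m_2. In a resonance m_1 a + m_2 b, b ≥ 2 is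
too heavy, b = 1 forces a = 0, and b = 0 forces a = 1, because m_1 a = m_2 is excluded. -/
theorem resonanceOrder_eq_one_of_normal {m : Fin 2 → ℕ} (h2 : 2 ≤ m 0) (hle : m 0 ≤ m 1)
    (hgcd : Nat.gcd (m 0) (m 1) = 1) : resonanceOrder m = 1 := by
  have hlt : m 0 < m 1 := by
    refine lt_of_le_of_ne hle fun h => ?_
    rw [← h, Nat.gcd_self] at hgcd
    omega
  refine resonanceOrder_eq_one two_pos (fun j => by fin_cases j <;> simp <;> omega)
    fun i α hα => ?_
  simp only [resonanceSetAt, mem_ofPred_eq, Fin.sum_univ_two] at hα ⊢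
  have key : ∀ a b w : ℕ, m 0 * a + m 1 * b = w → (w = m 0 ∨ w = m 1) → a + b ≤ 1 := by
    intro a b w hw hor
    rcases Nat.lt_or_ge 1 b with hb | hb
    · nlinarith [hor.elim (fun h => h.le.trans hle) le_of_eq]
    · interval_cases b
      · rcases hor with rfl | rfl
        · have : m 0 * a = m 0 * 1 := by simpa using hw
          exact (Nat.eq_of_mul_eq_mul_left (by omega) this).le
        · have hdvd : m 0 ∣ m 1 := ⟨a, by simpa using hw.symm⟩
          rw [Nat.gcd_eq_left hdvd] at hgcd
          omega
      · have : m 0 * a = 0 := by rcases hor with h | h <;> omega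
        rcases Nat.mul_eq_zero.1 this with h | h <;> omega
  exact key _ _ _ hα (by fin_cases i <;> simp)

end QuasiCircular

theorem corollary1p2 :
    (∀ (n : ℕ) (m : Fin n → ℕ) (D : Set (Fin n → ℂ)),
      QuasiCircular.IsQuasiCircularDomain m D → Bornology.IsBounded D →
      (0 : Fin n → ℂ) ∈ D → QuasiCircular.resonanceOrder m = 1 →
      ∀ f : (Fin n → ℂ) → (Fin n → ℂ), QuasiCircular.IsAutomorphism D f → f 0 = 0 →
        ∃ L : (Fin n → ℂ) →ₗ[ℂ] (Fin n → ℂ), Set.EqOn f L D) ∧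
    (∀ (n : ℕ) (m : Fin n → ℕ), 0 < n → (∀ j, 0 < m j) → (∀ i j, m i = m j) →
      QuasiCircular.resonanceOrder m = 1) ∧
    (∀ m : Fin 2 → ℕ, 2 ≤ m 0 → m 0 ≤ m 1 → Nat.gcd (m 0) (m 1) = 1 →
      QuasiCircular.resonanceOrder m = 1) := by
  refine ⟨?_, fun n m hn hm h => QuasiCircular.resonanceOrder_eq_one_of_forall_eq hn hm h,
    fun m h2 hle hgcd => QuasiCircular.resonanceOrder_eq_one_of_normal h2 hle hgcd⟩
  rintro n m D hD hb h0 hres f ⟨hf, hfm, g, hg, hgm, hinv⟩ hf0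
  have hg0 : g 0 = 0 := by simpa [hf0] using hinv.1 h0
  have hpair : QuasiCircular.IsIsotropyPair D f g := ⟨hf, hg, hfm, hgm, hinv, hf0, hg0⟩
  exact ⟨(fderiv ℂ f 0 : (Fin n → ℂ) →ₗ[ℂ] (Fin n → ℂ)), hpair.eqOn_fderiv hD hb h0
    fun i α hα => QuasiCircular.sum_le_one_of_resonanceOrder_eq_one hD.weight_pos hres i hα⟩
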